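/- Let $r\ge 2$ be an integer and let $C>(2^r e r)^{1/(r-1)}$ be a real constant. Then there is a constant $A>0$, depending only on $r$ and $C$, such that the following holds. For every integer $n\ge 1$, let $H=H(n)$ be a linear $r$-uniform hypergraph on $n$ vertices (every edge has exactly $r$ vertices, and each pair of distinct vertices is contained in at most one edge), let $\Delta=\Delta(n)$ be its maximum degree, and let $k=k(n)$ and $\sigma=\sigma(n)$ be integers with $0 \le k\le \sigma$, $$k\ge A(\log n)^{1/r}\quad\text{and}\quad \sigma\ge C\,\Delta^{1/(r-1)}.$$ Let $L$ be a random $(k,\sigma)$-list assignment for $H$, that is, the lists $L(v)$, for $v\in V(H)$, are chosen independently and uniformly at random from all $k$-element subsets of $\{1,\dots,\sigma\}$. Then $H$ is $L$-colorable with high probability: $$\lim_{n\to\infty}\mathbb{P}\bigl[\,H(n)\text{ is }L\text{-colorable}\,\bigr]=1,$$ where $H$ is $L$-colorable if there is a map $\varphi$ on $V(H)$ with $\varphi(v)\in L(v)$ for every vertex $v$ such that no edge of $H$ is monochromatic under $\varphi$. -/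

import Mathlib

open Filter Topology MeasureTheory ProbabilityTheory
open scoped Hypergraph

namespace Hypergraph

variable {α γ : Type*}

/-- `H` is `r`-uniform: every edge consists of exactly `r` vertices. -/
def IsUniform (H : Hypergraph α) (r : ℕ) : Prop :=
  ∀ e ∈ E(H), e.encard = r

/-- `H` is linear: each pair of distinct vertices lies in at most one common edge. -/
def IsLinear (H : Hypergraph α) : Prop :=
  ∀ x y : α, x ≠ y → ∀ e ∈ E(H), ∀ f ∈ E(H), x ∈ e → y ∈ e → x ∈ f → y ∈ f → e = f

/-- The degree of `v`: the number of edges containing `v`. -/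
noncomputable def degree (H : Hypergraph α) (v : α) : ℕ :=
  {e ∈ E(H) | v ∈ e}.ncard

/-- The maximum degree of a hypergraph on a finite vertex type. -/
noncomputable def maxDegree [Fintype α] (H : Hypergraph α) : ℕ :=
  Finset.univ.sup H.degree

/-- `φ` is a proper colouring of `H`: no edge is monochromatic. -/
def IsProperColoring (H : Hypergraph α) (φ : α → γ) : Prop :=
  ∀ e ∈ E(H), ¬ ∃ c, ∀ v ∈ e, φ v = c

/-- `H` is `L`-colorable: it has a proper colouring taking the colour of each vertex `v` from its
list `L v`. -/
def IsListColorable (H : Hypergraph α) (L : α → Finset γ) : Prop :=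
  ∃ φ : α → γ, H.IsProperColoring φ ∧ ∀ v ∈ V(H), φ v ∈ L v

end Hypergraph

/-- The law of a random `(k, σ)`-list assignment on the vertex set `V`: the lists of the vertices
are chosen independently, each uniformly at random from all `k`-subsets of a set of `σ` colours.
It is a probability measure when `k ≤ σ` (for `σ < k` there is no `k`-subset). -/
noncomputable def randomListAssignment (V : Type*) [Fintype V] (k σ : ℕ) :
    Measure (V → Finset (Fin σ)) :=
  Measure.pi fun _ : V => uniformOn {S : Finset (Fin σ) | S.card = k}

/-! Write r = s + 1, q = k/σ and D = 2(k/C)^s. Given L(v) and a colour c in it, the number of edges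
at v with c in all their lists has mean at most Δ q^s ≤ (k/C)^s = D/2. Two facts combine.
Concentration: by linearity the sets e \ {v} are disjoint, so the events behind these counts have
the joint bounds of independent ones (`sum_two_pow_le`). If more than half of L(v) has degree above
D, some B ⊆ L(v) with more than k/2 colours has total degree at least |B| D. A union over such B
costs only 2^k against a tail exp(-c k^r), and k ≥ A (log n)^(1/r) then beats a union over the n
vertices. Colouring: deleting the high-degree colours leaves lists of size at least k/2 and colour
degrees at most D. A counting induction (`exists_proper_list_coloring`) shows that each new vertex
multiplies the number of partial colourings by at least β > 0. It needs D e r ≤ (k/2)^s, that is 2^r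
e r ≤ C^s, which is the hypothesis on C. -/

/-! ### Colouring by counting partial colourings. -/

section Counting

variable {V γ : Type*}

/-- Multiplicative growth along single insertions gives growth along inclusions. -/
lemma pow_card_sdiff_mul_le [DecidableEq V] {N : Finset V → ℝ} {β : ℝ} (hβ : 0 ≤ β) {S T : Finset V}
    (hTS : T ⊆ S)
    (h : ∀ U : Finset V, U ⊆ S → ∀ w ∈ S, w ∉ U → β * N U ≤ N (insert w U)) :
    β ^ (S \ T).card * N T ≤ N S := by
  induction hm : (S \ T).card generalizing T with
  | zero =>
    have : S = T := (Finset.sdiff_eq_empty_iff_subset.1 (Finset.card_eq_zero.1 hm)).antisymm hTS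
    simp [this]
  | succ m ih =>
    obtain ⟨w, hw⟩ := Finset.card_pos.1 (by omega : 0 < (S \ T).card)
    obtain ⟨hwS, hwT⟩ := Finset.mem_sdiff.1 hw
    have hc : (S \ insert w T).card = m := by
      have : S \ insert w T = (S \ T).erase w := by ext; grind
      rw [this, Finset.card_erase_of_mem hw, hm]; rfl
    have := ih (T := insert w T) (Finset.insert_subset hwS hTS) hc
    calc β ^ (m + 1) * N T = β ^ m * (β * N T) := by ring
      _ ≤ β ^ m * N (insert w T) := by gcongr; exact h T hTS w hwS hwT
      _ ≤ N S := this

variable [Fintype V] [DecidableEq V] [DecidableEq γ]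

/-- The proper list colourings of the sub-hypergraph induced on `S`, extended by the fixed map
`f₀` outside of `S`. -/
def partialColorings (E : Finset (Finset V)) (L : V → Finset γ) (f₀ : V → γ) (S : Finset V) :
    Finset (V → γ) :=
  (Fintype.piFinset fun u => if u ∈ S then L u else {f₀ u}).filter fun f =>
    -- Bounding c by `e.image f` keeps the predicate decidable and changes nothing on nonempty
    -- edges.
    ∀ e ∈ E, e ⊆ S → ¬ ∃ c ∈ e.image f, ∀ u ∈ e, f u = c

lemma mem_partialColorings {E : Finset (Finset V)} {L : V → Finset γ} {f₀ : V → γ}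
    {S : Finset V} {f : V → γ} :
    f ∈ partialColorings E L f₀ S ↔ (∀ u ∈ S, f u ∈ L u) ∧ (∀ u ∉ S, f u = f₀ u) ∧
      ∀ e ∈ E, e ⊆ S → ¬ ∃ c ∈ e.image f, ∀ u ∈ e, f u = c := by
  simp only [partialColorings, Finset.mem_filter, Fintype.mem_piFinset, ← and_assoc]
  refine and_congr_left fun _ => ⟨fun h => ⟨fun u hu => ?_, fun u hu => ?_⟩, fun h u => ?_⟩
  · simpa [hu] using h u
  · simpa [hu] using h u
  · by_cases hu : u ∈ S
    · simpa [hu] using h.1 u hu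
    · simpa [hu] using h.2 u hu

/-- Partial colourings of `S` in which `e \ {v}` has the prescribed colour `c` are determined by
their restriction to `S \ e`. -/
lemma card_partialColorings_filter_le (E : Finset (Finset V)) (L : V → Finset γ) (f₀ : V → γ)
    (S e : Finset V) (v : V) (c : γ) :
    ((partialColorings E L f₀ S).filter fun f => ∀ u ∈ e.erase v, f u = c).card ≤
      (partialColorings E L f₀ (S \ e.erase v)).card := by
  -- Resetting f to `f₀` on e \ {v} loses nothing, since f is constantly c there.
  refine Finset.card_le_card_of_injOn (fun f u => if u ∈ e.erase v then f₀ u else f u) ?_ ?_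
  · intro f hf
    obtain ⟨hf, -⟩ := Finset.mem_filter.1 hf
    obtain ⟨h1, h2, h3⟩ := mem_partialColorings.1 hf
    refine mem_partialColorings.2 ⟨fun u hu => ?_, fun u hu => ?_, fun e' he' hs => ?_⟩
    · obtain ⟨a, b⟩ := Finset.mem_sdiff.1 hu
      simp only [if_neg b]; exact h1 u a
    · by_cases hue : u ∈ e.erase v
      · simp only [if_pos hue]
      · simp only [if_neg hue]
        exact h2 u fun hS => hu (Finset.mem_sdiff.2 ⟨hS, hue⟩)
    · have hcongr : ∀ u ∈ e', (if u ∈ e.erase v then f₀ u else f u) = f u := fun u hu =>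
        if_neg (Finset.mem_sdiff.1 (hs hu)).2
      rintro ⟨c', hc', hm⟩
      rw [Finset.image_congr hcongr] at hc'
      exact h3 e' he' (hs.trans Finset.sdiff_subset)
        ⟨c', hc', fun u hu => (hcongr u hu) ▸ hm u hu⟩
  · intro f hf g hg hfg
    obtain ⟨-, hf⟩ := Finset.mem_filter.1 hf
    obtain ⟨-, hg⟩ := Finset.mem_filter.1 hg
    funext u
    by_cases hue : u ∈ e.erase v
    · rw [hf u hue, hg u hue]
    · have := congrFun hfg u
      simpa only [if_neg hue] using this

/-- Every pair of a partial colouring of `S` and a colour of `v` either gives a partial colouring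
of `insert v S` or creates a monochromatic edge at `v`. -/
lemma card_mul_card_le (E : Finset (Finset V)) (L : V → Finset γ) (f₀ : V → γ)
    (S : Finset V) (v : V) (hv : v ∉ S) :
    (L v).card * (partialColorings E L f₀ S).card ≤
      (partialColorings E L f₀ (insert v S)).card +
        ∑ c ∈ L v, ∑ e ∈ E.filter fun e => v ∈ e ∧ (∀ u ∈ e, c ∈ L u) ∧ e ⊆ insert v S,
          (partialColorings E L f₀ (S \ e.erase v)).card := by
  classical
  -- Pairs (c, f) in which f already gives colour c to all of some e \ {v}; this forces c into every
  -- list of e, so only colour degrees are charged.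
  set bad : Finset (γ × (V → γ)) := (L v).biUnion fun c =>
    (E.filter fun e => v ∈ e ∧ (∀ u ∈ e, c ∈ L u) ∧ e ⊆ insert v S).biUnion fun e =>
      ((partialColorings E L f₀ S).filter fun f => ∀ u ∈ e.erase v, f u = c).image
        fun f => (c, f) with hbad
  have hb : bad.card ≤ ∑ c ∈ L v,
      ∑ e ∈ E.filter fun e => v ∈ e ∧ (∀ u ∈ e, c ∈ L u) ∧ e ⊆ insert v S,
        (partialColorings E L f₀ (S \ e.erase v)).card := by
    refine Finset.card_biUnion_le.trans (Finset.sum_le_sum fun c _ => ?_)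
    refine Finset.card_biUnion_le.trans (Finset.sum_le_sum fun e _ => ?_)
    exact Finset.card_image_le.trans (card_partialColorings_filter_le E L f₀ S e v c)
  have hg : ((L v ×ˢ partialColorings E L f₀ S) \ bad).card ≤
      (partialColorings E L f₀ (insert v S)).card := by
    refine Finset.card_le_card_of_injOn (fun p => Function.update p.2 v p.1) ?_ ?_
    · rintro ⟨c, f⟩ hp
      obtain ⟨hp, hnb⟩ := Finset.mem_sdiff.1 (Finset.mem_coe.1 hp)
      obtain ⟨hc, hf⟩ := Finset.mem_product.1 hp
      obtain ⟨h1, h2, h3⟩ := mem_partialColorings.1 hf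
      have hne : ∀ u, u ≠ v → Function.update f v c u = f u := fun u hu => by simp [hu]
      refine mem_partialColorings.2 ⟨fun u hu => ?_, fun u hu => ?_, fun e he hs => ?_⟩
      · by_cases h : u = v
        · subst h; simpa using hc
        · simpa [h] using h1 u ((Finset.mem_insert.1 hu).resolve_left h)
      · rw [Finset.mem_insert, not_or] at hu
        simpa [hu.1] using h2 u hu.2
      · rintro ⟨c', hc', hm⟩
        by_cases hve : v ∈ e
        · have hcc : c = c' := by simpa using hm v hve
          subst hcc
          have hfe : ∀ u ∈ e.erase v, f u = c := fun u hu => by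
            rw [← hne u (Finset.ne_of_mem_erase hu)]; exact hm u (Finset.mem_of_mem_erase hu)
          refine hnb (Finset.mem_biUnion.2 ⟨c, hc, Finset.mem_biUnion.2 ⟨e, ?_, ?_⟩⟩)
          · refine Finset.mem_filter.2 ⟨he, hve, fun u hu => ?_, hs⟩
            by_cases h : u = v
            · subst h; exact hc
            · rw [← hfe u (Finset.mem_erase.2 ⟨h, hu⟩)]
              exact h1 u ((Finset.mem_insert.1 (hs hu)).resolve_left h)
          · exact Finset.mem_image.2 ⟨f, Finset.mem_filter.2 ⟨hf, hfe⟩, rfl⟩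
        · have hcongr : ∀ u ∈ e, Function.update f v c u = f u := fun u hu =>
            hne u fun h => hve (h ▸ hu)
          rw [Finset.image_congr hcongr] at hc'
          exact h3 e he ((Finset.subset_insert_iff_of_notMem hve).1 hs)
            ⟨c', hc', fun u hu => (hcongr u hu).symm.trans (hm u hu)⟩
    · rintro ⟨c, f⟩ hp ⟨c', f'⟩ hp' h
      have hf := (mem_partialColorings.1 (Finset.mem_product.1
        (Finset.mem_sdiff.1 (Finset.mem_coe.1 hp)).1).2).2.1 v hv
      have hf' := (mem_partialColorings.1 (Finset.mem_product.1
        (Finset.mem_sdiff.1 (Finset.mem_coe.1 hp')).1).2).2.1 v hv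
      refine Prod.ext (by simpa using congrFun h v) (funext fun u => ?_)
      by_cases hu : u = v
      · subst hu; exact hf.trans hf'.symm
      · simpa [hu] using congrFun h u
  have hcard : (L v).card * (partialColorings E L f₀ S).card ≤
      ((L v ×ˢ partialColorings E L f₀ S) \ bad).card + bad.card := by
    rw [← Finset.card_product]
    exact Finset.card_le_card_sdiff_add_card
  omega

/-- A hypergraph whose edges have `s + 1` vertices is list colourable as soon as every list has at
least `ℓ` colours and the average colour degree over each list is at most
`ℓ ^ s / (e * (s + 1))`. -/
theorem exists_proper_list_coloring {E : Finset (Finset V)} {L : V → Finset γ} {s : ℕ}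
    (hs : 1 ≤ s) (hE : ∀ e ∈ E, e.card = s + 1) {ℓ D : ℝ} (hℓ : 0 < ℓ)
    (hL : ∀ v, ℓ ≤ (L v).card)
    (hdeg : ∀ v, ∑ c ∈ L v, ((E.filter fun e => v ∈ e ∧ ∀ u ∈ e, c ∈ L u).card : ℝ) ≤
      (L v).card * D)
    (hD : D * (Real.exp 1 * (s + 1)) ≤ ℓ ^ s) :
    ∃ f : V → γ, (∀ v, f v ∈ L v) ∧ ∀ e ∈ E, ¬ ∃ c, ∀ u ∈ e, f u = c := by
  have hne : ∀ v, (L v).Nonempty := fun v =>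
    Finset.card_pos.1 (by exact_mod_cast hℓ.trans_le (hL v))
  choose f₀ hf₀ using hne
  set N : Finset V → ℝ := fun S => ((partialColorings E L f₀ S).card : ℝ) with hN
  have hs0 : (0 : ℝ) < s := by exact_mod_cast hs
  -- This value maximises β^s (1 - β/ℓ), the largest D for which the induction closes when a list
  -- has size ℓ; (1 + 1/s)^s ≤ e then gives the constant.
  set β : ℝ := ℓ * (s / (s + 1)) with hβ
  have hβ0 : 0 < β := by positivity
  have hDβ : D ≤ β ^ s * (1 / (s + 1)) := by
    have h1 : ((s + 1 : ℝ) / s) ^ s ≤ Real.exp 1 := by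
      have := Real.add_one_le_exp (1 / (s : ℝ))
      calc ((s + 1 : ℝ) / s) ^ s = (1 / (s : ℝ) + 1) ^ s := by congr 1; field_simp; ring
        _ ≤ Real.exp (1 / (s : ℝ)) ^ s := by gcongr
        _ = Real.exp 1 := by rw [← Real.exp_nat_mul]; congr 1; field_simp
    have h2 : 1 ≤ Real.exp 1 * ((s : ℝ) / (s + 1)) ^ s := by
      calc (1 : ℝ) = ((s + 1 : ℝ) / s) ^ s * ((s : ℝ) / (s + 1)) ^ s := by
            rw [← mul_pow, div_mul_div_cancel₀ (by positivity), div_self (by positivity), one_pow]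
        _ ≤ _ := by gcongr
    rw [mul_one_div, le_div_iff₀ (by positivity), hβ, mul_pow]
    have h3 := mul_le_mul_of_nonneg_right hD (by positivity : 0 ≤ ((s : ℝ) / (s + 1)) ^ s)
    rcases le_or_gt D 0 with hD0 | hD0
    · exact (mul_nonpos_of_nonpos_of_nonneg hD0 (by positivity)).trans (by positivity)
    · calc D * (s + 1) ≤ D * (s + 1) * (Real.exp 1 * ((s : ℝ) / (s + 1)) ^ s) :=
            le_mul_of_one_le_right (by positivity) h2
        _ ≤ _ := by linarith
  have key : ∀ m : ℕ, ∀ S : Finset V, S.card = m → ∀ v ∉ S, β * N S ≤ N (insert v S) := by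
    intro m
    induction m using Nat.strong_induction_on with
    | _ m ih =>
    intro S hSm v hv
    -- By induction, uncolouring the s other vertices of e divides the count by at least β^s, which
    -- bounds the extensions spoiled by e.
    have hsub : ∀ e ∈ E, v ∈ e → e ⊆ insert v S → β ^ s * N (S \ e.erase v) ≤ N S := by
      intro e he hve hes
      have heS : e.erase v ⊆ S := Finset.subset_insert_iff.1 hes
      have hc : (S \ (S \ e.erase v)).card = s := by
        rw [Finset.sdiff_sdiff_eq_self heS, Finset.card_erase_of_mem hve, hE e he]; rfl
      have := pow_card_sdiff_mul_le (N := N) hβ0.le (Finset.sdiff_subset : S \ e.erase v ⊆ S)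
        (fun U hU w hw hwU => ih U.card (hSm ▸ Finset.card_lt_card
          ((Finset.ssubset_iff_of_subset hU).2 ⟨w, hw, hwU⟩)) U rfl w hwU)
      rwa [hc] at this
    have hN0 : 0 ≤ N S := Nat.cast_nonneg _
    have hmain : ((L v).card : ℝ) * N S ≤ N (insert v S) +
        ∑ c ∈ L v, ∑ e ∈ E.filter fun e => v ∈ e ∧ (∀ u ∈ e, c ∈ L u) ∧ e ⊆ insert v S,
          N (S \ e.erase v) := by
      have := card_mul_card_le E L f₀ S v hv
      simp only [hN]
      exact_mod_cast this
    have hbad : ∑ c ∈ L v, ∑ e ∈ E.filter fun e =>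
          v ∈ e ∧ (∀ u ∈ e, c ∈ L u) ∧ e ⊆ insert v S, N (S \ e.erase v) ≤
        (L v).card * D * (N S / β ^ s) := by
      refine le_trans ?_ (mul_le_mul_of_nonneg_right (hdeg v) (by positivity))
      rw [Finset.sum_mul]
      refine Finset.sum_le_sum fun c _ => ?_
      calc _ ≤ ∑ e ∈ E.filter fun e => v ∈ e ∧ (∀ u ∈ e, c ∈ L u) ∧ e ⊆ insert v S,
            N S / β ^ s := by
            refine Finset.sum_le_sum fun e he => ?_
            obtain ⟨he, hve, -, hes⟩ := Finset.mem_filter.1 he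
            rw [le_div_iff₀ (by positivity), mul_comm]
            exact hsub e he hve hes
        _ ≤ _ := by
            rw [Finset.sum_const, nsmul_eq_mul]
            gcongr
            intro h; tauto
    have h1 : ((L v).card : ℝ) * D * (N S / β ^ s) ≤ (L v).card * (1 / (s + 1)) * N S := by
      calc ((L v).card : ℝ) * D * (N S / β ^ s)
          ≤ (L v).card * (β ^ s * (1 / (s + 1))) * (N S / β ^ s) := by gcongr
        _ = _ := by field_simp
    have h2 : β * N S ≤ (L v).card * (s / (s + 1)) * N S := by
      rw [hβ]; gcongr; exact hL v
    have h3 : ((L v).card : ℝ) * N S =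
        (L v).card * (1 / (s + 1)) * N S + (L v).card * (s / (s + 1)) * N S := by
      field_simp; ring
    linarith
  have hfin := pow_card_sdiff_mul_le (N := N) hβ0.le (Finset.subset_univ (∅ : Finset V))
    (fun U _ w _ hw => key U.card U rfl w hw)
  -- `f₀` is counted, because no edge is empty.
  have hempty : 0 < N ∅ := by
    simp only [hN, Nat.cast_pos, Finset.card_pos]
    refine ⟨f₀, mem_partialColorings.2 ⟨by simp, by simp, fun e he h => ?_⟩⟩
    have := hE e he
    rw [Finset.subset_empty.1 h] at this
    simp at this
  have hpos : 0 < N Finset.univ := lt_of_lt_of_le (by positivity) hfin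
  obtain ⟨f, hf⟩ := Finset.card_pos.1 (Nat.cast_pos.1 hpos)
  obtain ⟨h1, -, h3⟩ := mem_partialColorings.1 hf
  refine ⟨f, fun v => h1 v (Finset.mem_univ v), fun e he ⟨c, hc⟩ => ?_⟩
  obtain ⟨u, hu⟩ := Finset.card_pos.1 (by rw [hE e he]; omega : 0 < e.card)
  exact h3 e he (Finset.subset_univ e) ⟨c, Finset.mem_image.2 ⟨u, hu, hc u hu⟩, hc⟩

end Counting

/-! ### Concentration of colour degrees for random lists. -/

section RandomLists

/-- A given set `S` is contained in a uniformly random `k`-subset of a type of size `σ` with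
probability at most `(k / σ) ^ #S`. -/
lemma card_filter_superset_powersetCard_le {γ : Type*} [Fintype γ] [DecidableEq γ] {k : ℕ}
    (hk : k ≤ Fintype.card γ) (S : Finset γ) :
    (((Finset.powersetCard k (Finset.univ : Finset γ)).filter fun T => S ⊆ T).card : ℝ) ≤
      (Finset.powersetCard k (Finset.univ : Finset γ)).card *
        ((k : ℝ) / Fintype.card γ) ^ S.card := by
  induction S using Finset.induction_on with
  | empty => simp
  | insert a S ha ih =>
    set P := Finset.powersetCard k (Finset.univ : Finset γ)
    set σ := Fintype.card γ
    have hσ : 0 < σ := Fintype.card_pos_iff.2 ⟨a⟩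
    by_cases hSk : k < S.card
    · have : (P.filter fun T => insert a S ⊆ T) = ∅ := by
        refine Finset.filter_eq_empty_iff.2 fun T hT h => ?_
        have h1 := Finset.card_le_card ((Finset.subset_insert a S).trans h)
        rw [(Finset.mem_powersetCard.1 hT).2] at h1
        omega
      rw [this]; simp only [Finset.card_empty, Nat.cast_zero]; positivity
    · push Not at hSk
      -- By symmetry every b outside S has the same count; counting pairs (b, T) with b ∈ T \ S
      -- gives the exact ratio (k - |S|)/(σ - |S|) ≤ k/σ.
      have hcount : ∀ b ∉ S, (P.filter fun T => insert b S ⊆ T).card =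
          (P.filter fun T => insert a S ⊆ T).card := by
        intro b hb
        have hmem : ∀ x ∈ S, Equiv.swap a b x = x := fun x hx =>
          Equiv.swap_apply_of_ne_of_ne (fun h => ha (h ▸ hx)) (fun h => hb (h ▸ hx))
        refine Finset.card_bij' (fun T _ => T.map (Equiv.swap a b).toEmbedding)
          (fun T _ => T.map (Equiv.swap a b).toEmbedding) ?_ ?_ ?_ ?_
        · intro T hT
          obtain ⟨h1, h2⟩ := Finset.mem_filter.1 hT
          refine Finset.mem_filter.2 ⟨?_, Finset.insert_subset ?_ fun x hx => ?_⟩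
          · simpa [P, Finset.mem_powersetCard] using h1
          · exact Finset.mem_map.2 ⟨b, h2 (Finset.mem_insert_self b S), by simp⟩
          · exact Finset.mem_map.2 ⟨x, h2 (Finset.mem_insert_of_mem hx), hmem x hx⟩
        · intro T hT
          obtain ⟨h1, h2⟩ := Finset.mem_filter.1 hT
          refine Finset.mem_filter.2 ⟨?_, Finset.insert_subset ?_ fun x hx => ?_⟩
          · simpa [P, Finset.mem_powersetCard] using h1
          · exact Finset.mem_map.2 ⟨a, h2 (Finset.mem_insert_self a S), by simp⟩
          · exact Finset.mem_map.2 ⟨x, h2 (Finset.mem_insert_of_mem hx), hmem x hx⟩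
        · intro T _; ext x; simp
        · intro T _; ext x; simp
      have hdouble : ∑ b ∈ Sᶜ, (P.filter fun T => insert b S ⊆ T).card =
          (P.filter fun T => S ⊆ T).card * (k - S.card) := by
        have : ∀ T ∈ P.filter fun T => S ⊆ T, (T \ S).card = k - S.card := by
          intro T hT
          obtain ⟨h1, h2⟩ := Finset.mem_filter.1 hT
          rw [Finset.card_sdiff_of_subset h2, (Finset.mem_powersetCard.1 h1).2]
        rw [← smul_eq_mul, ← Finset.sum_const, ← Finset.sum_congr rfl this]
        simp_rw [Finset.card_eq_sum_ones]
        refine Finset.sum_comm' fun b T => ?_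
        simp only [Finset.mem_compl, Finset.mem_filter, Finset.mem_sdiff, Finset.insert_subset_iff]
        tauto
      rw [Finset.sum_congr rfl fun b hb => hcount b (Finset.mem_compl.1 hb), Finset.sum_const,
        Finset.card_compl, smul_eq_mul] at hdouble
      have hSσ : S.card < σ := Finset.card_lt_univ_of_notMem ha
      have hd : ((σ : ℝ) - S.card) * (P.filter fun T => insert a S ⊆ T).card =
          (P.filter fun T => S ⊆ T).card * ((k : ℝ) - S.card) := by
        rw [← Nat.cast_sub hSσ.le, ← Nat.cast_sub hSk]; exact_mod_cast hdouble
      have hσR : (0 : ℝ) < σ := by exact_mod_cast hσ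
      have hsub : (0 : ℝ) < (σ : ℝ) - S.card := sub_pos.2 (by exact_mod_cast hSσ)
      have hkσ : (k : ℝ) ≤ σ := by exact_mod_cast hk
      have hratio : ((k : ℝ) - S.card) / ((σ : ℝ) - S.card) ≤ k / σ := by
        rw [div_le_div_iff₀ hsub hσR]
        nlinarith [mul_le_mul_of_nonneg_right hkσ (Nat.cast_nonneg (α := ℝ) S.card)]
      calc ((P.filter fun T => insert a S ⊆ T).card : ℝ)
          = (P.filter fun T => S ⊆ T).card * (((k : ℝ) - S.card) / ((σ : ℝ) - S.card)) := by
            rw [← mul_div_assoc, ← hd]; field_simp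
        _ ≤ (P.filter fun T => S ⊆ T).card * (k / σ) := by gcongr
        _ ≤ (P.card * ((k : ℝ) / σ) ^ S.card) * (k / σ) := by gcongr
        _ = _ := by rw [Finset.card_insert_of_notMem ha, pow_succ, mul_assoc]

variable {V γ : Type*} [Fintype V] [DecidableEq V] [DecidableEq γ]

/-- Number of list assignments whose lists contain prescribed sets. -/
lemma card_filter_forall_subset (P : Finset (Finset γ)) (R : V → Finset γ) :
    ((Fintype.piFinset fun _ : V => P).filter fun L => ∀ u, R u ⊆ L u).card =
      ∏ u, (P.filter fun T => R u ⊆ T).card := by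
  rw [← Fintype.card_piFinset]
  congr 1
  ext L
  simp [Fintype.mem_piFinset, forall_and]

/-- Exponential moment of the number of pairs of a colour `c ∈ B` and an edge `e ∋ v` with `c` in
all lists of `e \ {v}`, over independent random lists and restricted to `B ⊆ L v`. -/
lemma sum_two_pow_le {P : Finset (Finset γ)} {q : ℝ}
    (hP : ∀ S : Finset γ, ((P.filter fun T => S ⊆ T).card : ℝ) ≤ P.card * q ^ S.card)
    {v : V} {s : ℕ} {I : Finset (Finset V)} (hv : ∀ e ∈ I, v ∈ e) (hI : ∀ e ∈ I, e.card = s + 1)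
    (hlin : ∀ u, u ≠ v → ∀ e ∈ I, ∀ f ∈ I, u ∈ e → u ∈ f → e = f) (B : Finset γ) :
    ∑ L ∈ (Fintype.piFinset fun _ : V => P).filter fun L => B ⊆ L v,
        (2 : ℝ) ^ ((B ×ˢ I).filter fun x => ∀ u ∈ x.2.erase v, x.1 ∈ L u).card ≤
      (P.filter fun T => B ⊆ T).card * (P.card : ℝ) ^ (Fintype.card V - 1) *
        (1 + q ^ s) ^ (B.card * I.card) := by
  set Ω := Fintype.piFinset fun _ : V => P
  -- The colours that the list of u must contain for all pairs of W to occur; at v this is B itself.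
  set R : Finset (γ × Finset V) → V → Finset γ := fun W u =>
    if u = v then B else (W.filter fun x => u ∈ x.2).image Prod.fst with hR
  have hRv : ∀ W, R W v = B := fun W => by simp [hR]
  have hRu : ∀ W u, u ≠ v → R W u = (W.filter fun x => u ∈ x.2).image Prod.fst := fun W u hu => by
    simp [hR, hu]
  -- 2^Z is the number of subsets W of the Z pairs that occur, so the moment becomes a sum of joint
  -- probabilities.
  have hexp : ∀ L : V → Finset γ,
      (2 : ℝ) ^ ((B ×ˢ I).filter fun x => ∀ u ∈ x.2.erase v, x.1 ∈ L u).card =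
        ((B ×ˢ I).powerset.filter fun W => ∀ x ∈ W, ∀ u ∈ x.2.erase v, x.1 ∈ L u).card := by
    intro L
    rw [show (2 : ℝ) = ((2 : ℕ) : ℝ) by norm_num, ← Nat.cast_pow, ← Finset.card_powerset]
    congr 2
    ext W
    simp only [Finset.mem_powerset, Finset.mem_filter, Finset.subset_iff]
    grind
  have hW : ∀ W ∈ (B ×ˢ I).powerset,
      ((Ω.filter fun L => B ⊆ L v ∧ ∀ x ∈ W, ∀ u ∈ x.2.erase v, x.1 ∈ L u).card : ℝ) ≤
        (P.filter fun T => B ⊆ T).card * (P.card : ℝ) ^ (Fintype.card V - 1) *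
          (q ^ s) ^ W.card := by
    intro W hW
    have hWI : ∀ x ∈ W, x.2 ∈ I := fun x hx =>
      (Finset.mem_product.1 (Finset.mem_powerset.1 hW hx)).2
    have h1 : (Ω.filter fun L => B ⊆ L v ∧ ∀ x ∈ W, ∀ u ∈ x.2.erase v, x.1 ∈ L u) =
        Ω.filter fun L => ∀ u, R W u ⊆ L u := by
      refine Finset.filter_congr fun L _ => ⟨fun h u => ?_, fun h => ⟨?_, fun x hx u hu => ?_⟩⟩
      · by_cases hu : u = v
        · subst hu; rw [hRv]; exact h.1
        · rw [hRu W u hu]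
          intro c hc
          obtain ⟨x, hx, rfl⟩ := Finset.mem_image.1 hc
          obtain ⟨hx, hux⟩ := Finset.mem_filter.1 hx
          exact h.2 x hx u (Finset.mem_erase.2 ⟨hu, hux⟩)
      · have := h v; rwa [hRv] at this
      · obtain ⟨hu, hux⟩ := Finset.mem_erase.1 hu
        have := h u
        rw [hRu W u hu] at this
        exact this (Finset.mem_image.2 ⟨x, Finset.mem_filter.2 ⟨hx, hux⟩, rfl⟩)
    have hcardR : ∀ u ∈ Finset.univ.erase v,
        (R W u).card = (W.filter fun x => u ∈ x.2).card := by
      intro u hu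
      have hu := Finset.ne_of_mem_erase hu
      rw [hRu W u hu]
      -- Linearity enters here: u ≠ v lies in only one edge of I, so distinct pairs of W through u
      -- have distinct colours.
      refine Finset.card_image_of_injOn fun x hx y hy hxy => ?_
      obtain ⟨hx, hux⟩ := Finset.mem_filter.1 (Finset.mem_coe.1 hx)
      obtain ⟨hy, huy⟩ := Finset.mem_filter.1 (Finset.mem_coe.1 hy)
      exact Prod.ext hxy (hlin u hu _ (hWI x hx) _ (hWI y hy) hux huy)
    have hsum : ∑ u ∈ Finset.univ.erase v, (R W u).card = s * W.card := by
      have : ∀ x ∈ W, (x.2.erase v).card = s := fun x hx => by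
        rw [Finset.card_erase_of_mem (hv _ (hWI x hx)), hI _ (hWI x hx)]; rfl
      rw [Finset.sum_congr rfl hcardR, mul_comm, ← smul_eq_mul, ← Finset.sum_const,
        ← Finset.sum_congr rfl this]
      simp_rw [Finset.card_eq_sum_ones]
      refine Finset.sum_comm' fun u x => ?_
      simp only [Finset.mem_erase, Finset.mem_univ, Finset.mem_filter]
      tauto
    rw [h1, card_filter_forall_subset, ← Finset.mul_prod_erase _ _ (Finset.mem_univ v), hRv,
      Nat.cast_mul, mul_assoc]
    gcongr
    calc ((∏ u ∈ Finset.univ.erase v, (P.filter fun T => R W u ⊆ T).card : ℕ) : ℝ)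
        ≤ ∏ u ∈ Finset.univ.erase v, ((P.card : ℝ) * q ^ (R W u).card) := by
          push_cast
          exact Finset.prod_le_prod (fun _ _ => by positivity) fun u _ => hP _
      _ = _ := by
          rw [Finset.prod_mul_distrib, Finset.prod_const, Finset.prod_pow_eq_pow_sum, hsum,
            Finset.card_erase_of_mem (Finset.mem_univ v), Finset.card_univ, pow_mul]
  calc ∑ L ∈ Ω.filter fun L => B ⊆ L v,
        (2 : ℝ) ^ ((B ×ˢ I).filter fun x => ∀ u ∈ x.2.erase v, x.1 ∈ L u).card
      = ∑ L ∈ Ω.filter fun L => B ⊆ L v, ∑ W ∈ (B ×ˢ I).powerset,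
          if ∀ x ∈ W, ∀ u ∈ x.2.erase v, x.1 ∈ L u then (1 : ℝ) else 0 := by
        refine Finset.sum_congr rfl fun L _ => ?_
        rw [hexp L, Finset.sum_boole]
    _ = ∑ W ∈ (B ×ˢ I).powerset,
          ((Ω.filter fun L => B ⊆ L v ∧ ∀ x ∈ W, ∀ u ∈ x.2.erase v, x.1 ∈ L u).card : ℝ) := by
        rw [Finset.sum_comm]
        refine Finset.sum_congr rfl fun W _ => ?_
        rw [Finset.sum_boole, Finset.filter_filter]
    _ ≤ ∑ W ∈ (B ×ˢ I).powerset, (P.filter fun T => B ⊆ T).card *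
          (P.card : ℝ) ^ (Fintype.card V - 1) * (q ^ s) ^ W.card := Finset.sum_le_sum hW
    _ = _ := by
        rw [← Finset.mul_sum, ← Finset.card_product, add_comm, ← Finset.sum_pow_mul_eq_add_pow]
        simp

/-- Most list assignments leave few colours of high degree in the list of a given vertex. -/
lemma card_many_high_degree_colors_le [Fintype γ] {P : Finset (Finset γ)} {q : ℝ} (hq : 0 ≤ q)
    (hP : ∀ S : Finset γ, ((P.filter fun T => S ⊆ T).card : ℝ) ≤ P.card * q ^ S.card)
    {k : ℕ} (hPk : ∀ T ∈ P, T.card = k)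
    {v : V} {s : ℕ} {I : Finset (Finset V)} (hv : ∀ e ∈ I, v ∈ e) (hI : ∀ e ∈ I, e.card = s + 1)
    (hlin : ∀ u, u ≠ v → ∀ e ∈ I, ∀ f ∈ I, u ∈ e → u ∈ f → e = f)
    {D : ℝ} (hD : I.card * q ^ s ≤ D / 2) :
    (((Fintype.piFinset fun _ : V => P).filter fun L =>
        k < 2 * ((L v).filter fun c => D < (I.filter fun e => ∀ u ∈ e, c ∈ L u).card).card).card
          : ℝ) ≤
      (P.card : ℝ) ^ Fintype.card V * (2 ^ k * Real.exp (-(k / 2 * (D * (Real.log 2 - 1 / 2))))) := by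
  set Ω := Fintype.piFinset fun _ : V => P
  set bad : (V → Finset γ) → Finset γ := fun L =>
    (L v).filter fun c => D < (I.filter fun e => ∀ u ∈ e, c ∈ L u).card with hbad
  set Z : Finset γ → (V → Finset γ) → ℕ := fun B L =>
    ((B ×ˢ I).filter fun x => ∀ u ∈ x.2.erase v, x.1 ∈ L u).card with hZ
  set 𝓑 : Finset (Finset γ) := Finset.univ.filter fun B => k < 2 * B.card with h𝓑
  have hlog : 1 / 2 < Real.log 2 := by linarith [Real.log_two_gt_d9]
  have hD0 : 0 ≤ D := by have : 0 ≤ I.card * q ^ s := by positivity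
                         linarith
  have hZbad : ∀ L, ((bad L).card : ℝ) * D ≤ Z (bad L) L := by
    intro L
    have : Z (bad L) L = ∑ c ∈ bad L, (I.filter fun e => ∀ u ∈ e.erase v, c ∈ L u).card := by
      simp only [hZ, Finset.card_filter, Finset.sum_product]
    rw [this, ← nsmul_eq_mul, ← Finset.sum_const, Nat.cast_sum]
    refine Finset.sum_le_sum fun c hc => (Finset.mem_filter.1 hc).2.le.trans ?_
    refine Nat.cast_le.2 (Finset.card_le_card fun e he => ?_)
    obtain ⟨he, h⟩ := Finset.mem_filter.1 he
    exact Finset.mem_filter.2 ⟨he, fun u hu => h u (Finset.mem_of_mem_erase hu)⟩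
  -- Exponential Markov bound with base 2: the term B = `bad L` alone is at least 1.
  have hind : ∀ L, k < 2 * (bad L).card →
      1 ≤ ∑ B ∈ 𝓑, if B ⊆ L v then
        (2 : ℝ) ^ Z B L * Real.exp (-(B.card * D * Real.log 2)) else 0 := by
    intro L hL
    have h1 : (1 : ℝ) ≤ 2 ^ Z (bad L) L * Real.exp (-((bad L).card * D * Real.log 2)) := by
      have : (2 : ℝ) ^ Z (bad L) L = Real.exp (Z (bad L) L * Real.log 2) := by
        rw [Real.exp_nat_mul, Real.exp_log two_pos]
      rw [this, ← Real.exp_add, Real.one_le_exp_iff]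
      nlinarith [hZbad L]
    refine h1.trans ?_
    rw [← if_pos (c := bad L ⊆ L v) (Finset.filter_subset _ _)
      (t := (2 : ℝ) ^ Z (bad L) L * Real.exp (-((bad L).card * D * Real.log 2))) (e := 0)]
    refine Finset.single_le_sum (f := fun B => if B ⊆ L v then
        (2 : ℝ) ^ Z B L * Real.exp (-(B.card * D * Real.log 2)) else 0)
      (fun B _ => by positivity) (Finset.mem_filter.2 ⟨Finset.mem_univ _, hL⟩)
  -- The moment contributes at most exp(|B| D/2) and the threshold 2^(-|B| D); the net exponent is
  -- negative because log 2 > 1/2.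
  have hB : ∀ B ∈ 𝓑, (1 + q ^ s) ^ (B.card * I.card) * Real.exp (-(B.card * D * Real.log 2)) ≤
      Real.exp (-(k / 2 * (D * (Real.log 2 - 1 / 2)))) := by
    intro B hB
    have hkB : (k : ℝ) / 2 ≤ B.card := by
      have : (k : ℝ) < 2 * B.card := by exact_mod_cast (Finset.mem_filter.1 hB).2
      linarith
    calc (1 + q ^ s) ^ (B.card * I.card) * Real.exp (-(B.card * D * Real.log 2))
        ≤ Real.exp (q ^ s) ^ (B.card * I.card) * Real.exp (-(B.card * D * Real.log 2)) := by
          gcongr; rw [add_comm]; exact Real.add_one_le_exp _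
      _ = Real.exp (B.card * (I.card * q ^ s) - B.card * D * Real.log 2) := by
          rw [← Real.exp_nat_mul, ← Real.exp_add]; push_cast; ring_nf
      _ ≤ _ := by
          refine Real.exp_le_exp.2 ?_
          have h1 := mul_le_mul_of_nonneg_left hD (Nat.cast_nonneg (α := ℝ) B.card)
          have h2 : (k : ℝ) / 2 * (D * (Real.log 2 - 1 / 2)) ≤
              B.card * (D * (Real.log 2 - 1 / 2)) :=
            mul_le_mul_of_nonneg_right hkB (mul_nonneg hD0 (by linarith))
          linarith
  -- Swapping the sums, only the 2^k subsets of each possible L(v) count, so the union bound does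
  -- not depend on σ.
  have hsup : ∑ B ∈ 𝓑, ((P.filter fun T => B ⊆ T).card : ℝ) ≤ P.card * 2 ^ k := by
    calc ∑ B ∈ 𝓑, ((P.filter fun T => B ⊆ T).card : ℝ)
        ≤ ∑ B, ((P.filter fun T => B ⊆ T).card : ℝ) :=
          Finset.sum_le_univ_sum_of_nonneg fun _ => Nat.cast_nonneg _
      _ = ∑ T ∈ P, ((Finset.univ.filter fun B => B ⊆ T).card : ℝ) := by
          simp only [← Finset.sum_boole]; exact Finset.sum_comm
      _ = ∑ T ∈ P, (2 : ℝ) ^ k := by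
          refine Finset.sum_congr rfl fun T hT => ?_
          rw [show (Finset.univ.filter fun B => B ⊆ T) = T.powerset by ext; simp,
            Finset.card_powerset, hPk T hT]
          norm_num
      _ = _ := by simp
  have hV : P.card * (P.card : ℝ) ^ (Fintype.card V - 1) = (P.card : ℝ) ^ Fintype.card V := by
    rw [← pow_succ', Nat.sub_add_cancel (Fintype.card_pos_iff.2 ⟨v⟩)]
  calc ((Ω.filter fun L => k < 2 * (bad L).card).card : ℝ)
      = ∑ L ∈ Ω.filter fun L => k < 2 * (bad L).card, (1 : ℝ) := by simp
    _ ≤ ∑ L ∈ Ω.filter fun L => k < 2 * (bad L).card, ∑ B ∈ 𝓑, if B ⊆ L v then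
          (2 : ℝ) ^ Z B L * Real.exp (-(B.card * D * Real.log 2)) else 0 :=
        Finset.sum_le_sum fun L hL => hind L (Finset.mem_filter.1 hL).2
    _ ≤ ∑ L ∈ Ω, ∑ B ∈ 𝓑, if B ⊆ L v then
          (2 : ℝ) ^ Z B L * Real.exp (-(B.card * D * Real.log 2)) else 0 :=
        Finset.sum_le_sum_of_subset_of_nonneg (Finset.filter_subset _ _) fun L _ _ =>
          Finset.sum_nonneg fun B _ => by positivity
    _ = ∑ B ∈ 𝓑, (∑ L ∈ Ω.filter fun L => B ⊆ L v, (2 : ℝ) ^ Z B L) *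
          Real.exp (-(B.card * D * Real.log 2)) := by
        rw [Finset.sum_comm]
        refine Finset.sum_congr rfl fun B _ => ?_
        rw [← Finset.sum_filter, Finset.sum_mul]
    _ ≤ ∑ B ∈ 𝓑, ((P.filter fun T => B ⊆ T).card * (P.card : ℝ) ^ (Fintype.card V - 1)) *
          Real.exp (-(k / 2 * (D * (Real.log 2 - 1 / 2)))) := by
        refine Finset.sum_le_sum fun B hB' => ?_
        refine (mul_le_mul_of_nonneg_right (sum_two_pow_le hP hv hI hlin B)
          (Real.exp_nonneg _)).trans ?_
        rw [mul_assoc _ ((1 + q ^ s) ^ _)]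
        exact mul_le_mul_of_nonneg_left (hB B hB') (by positivity)
    _ = (∑ B ∈ 𝓑, ((P.filter fun T => B ⊆ T).card : ℝ)) *
          ((P.card : ℝ) ^ (Fintype.card V - 1) *
            Real.exp (-(k / 2 * (D * (Real.log 2 - 1 / 2))))) := by
        rw [Finset.sum_mul]; exact Finset.sum_congr rfl fun B _ => by ring
    _ ≤ (P.card * 2 ^ k) * ((P.card : ℝ) ^ (Fintype.card V - 1) *
            Real.exp (-(k / 2 * (D * (Real.log 2 - 1 / 2))))) := by gcongr
    _ = _ := by rw [← hV]; ring

end RandomLists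

/-! ### From few high-degree colours to a probability bound. -/

section Assembly

/-- Lists of size `k` in which at most half of the colours have large degree allow a proper
colouring. -/
lemma exists_coloring_of_few_high_degree_colors {V γ : Type*} [Fintype V] [DecidableEq V]
    [DecidableEq γ] {E : Finset (Finset V)} {s : ℕ} (hs : 1 ≤ s) (hE : ∀ e ∈ E, e.card = s + 1)
    {k : ℕ} (hk : 1 ≤ k) {L : V → Finset γ} (hLk : ∀ v, (L v).card = k) {D : ℝ}
    (hD : D * (Real.exp 1 * (s + 1)) ≤ ((k : ℝ) / 2) ^ s)
    (hbad : ∀ v, 2 * ((L v).filter fun c =>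
      D < ((E.filter fun e => v ∈ e).filter fun e => ∀ u ∈ e, c ∈ L u).card).card ≤ k) :
    ∃ f : V → γ, (∀ v, f v ∈ L v) ∧ ∀ e ∈ E, ¬ ∃ c, ∀ u ∈ e, f u = c := by
  set L' : V → Finset γ := fun v => (L v).filter fun c =>
    ¬ D < ((E.filter fun e => v ∈ e).filter fun e => ∀ u ∈ e, c ∈ L u).card with hL'
  have hsub : ∀ v, L' v ⊆ L v := fun v => Finset.filter_subset _ _
  have hcol := exists_proper_list_coloring (L := L') (ℓ := k / 2) (D := D) hs hE
    (by positivity) (fun v => ?_) (fun v => ?_) hD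
  · obtain ⟨f, hf, hfE⟩ := hcol
    exact ⟨f, fun v => hsub v (hf v), hfE⟩
  · have h1 := Finset.card_filter_add_card_filter_not (s := L v)
      (fun c => D < ((E.filter fun e => v ∈ e).filter fun e => ∀ u ∈ e, c ∈ L u).card)
    rw [hLk v] at h1
    have h2 : k ≤ 2 * (L' v).card := by have := hbad v; simp only [hL']; omega
    have h3 : (k : ℝ) ≤ 2 * (L' v).card := by exact_mod_cast h2
    linarith
  -- Shrinking the lists only lowers colour degrees, so the surviving colours still have degree at
  -- most D.
  · rw [← nsmul_eq_mul, ← Finset.sum_const]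
    refine Finset.sum_le_sum fun c hc => le_trans ?_ (not_lt.1 (Finset.mem_filter.1 hc).2)
    refine Nat.cast_le.2 (Finset.card_le_card fun e he => ?_)
    obtain ⟨he, hv, h⟩ := Finset.mem_filter.1 he
    exact Finset.mem_filter.2 ⟨Finset.mem_filter.2 ⟨he, hv⟩, fun u hu => hsub u (h u hu)⟩

lemma isProbabilityMeasure_randomListAssignment (V : Type*) [Fintype V] {k σ : ℕ} (h : k ≤ σ) :
    IsProbabilityMeasure (randomListAssignment V k σ) := by
  have hne : {S : Finset (Fin σ) | S.card = k}.Nonempty := by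
    obtain ⟨S, -, hS⟩ := Finset.exists_subset_card_eq
      (s := (Finset.univ : Finset (Fin σ))) (n := k) (by simpa using h)
    exact ⟨S, hS⟩
  have := isProbabilityMeasure_uniformOn (Set.toFinite _) hne
  unfold randomListAssignment
  infer_instance

/-- A random list assignment is uniformly distributed over all list assignments. -/
lemma randomListAssignment_apply_finset {V : Type*} [Fintype V] [DecidableEq V] {k σ : ℕ}
    (h : k ≤ σ) {G : Finset (V → Finset (Fin σ))}
    (hG : G ⊆ Fintype.piFinset fun _ => Finset.powersetCard k Finset.univ) :
    randomListAssignment V k σ G = ENNReal.ofReal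
      (G.card / ((Finset.powersetCard k (Finset.univ : Finset (Fin σ))).card : ℝ) ^
        Fintype.card V) := by
  set P := Finset.powersetCard k (Finset.univ : Finset (Fin σ)) with hP
  have hPset : {S : Finset (Fin σ) | S.card = k} = P := by
    ext S; simp [hP, Finset.mem_powersetCard]
  have hPpos : 0 < P.card := by
    rw [hP, Finset.card_powersetCard]; exact Nat.choose_pos (by simpa using h)
  have hne : (P : Set (Finset (Fin σ))).Nonempty := Finset.card_pos.1 hPpos
  have := isProbabilityMeasure_uniformOn (Set.toFinite _) hne
  have hsing : ∀ L ∈ G, randomListAssignment V k σ {L} =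
      ENNReal.ofReal ((((P.card : ℝ) ^ Fintype.card V))⁻¹) := by
    intro L hL
    have hLP : ∀ u, L u ∈ P := fun u => Fintype.mem_piFinset.1 (hG hL) u
    rw [randomListAssignment, hPset, Measure.pi_singleton]
    have : ∀ u, uniformOn (P : Set (Finset (Fin σ))) {L u} = ENNReal.ofReal ((P.card : ℝ)⁻¹) := by
      intro u
      have h1 := uniformOn_apply_finset (s := P) (t := {L u})
      rw [Finset.inter_singleton_of_mem (hLP u), Finset.coe_singleton] at h1
      rw [h1, Finset.card_singleton, ENNReal.ofReal_inv_of_pos (by exact_mod_cast hPpos),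
        ENNReal.ofReal_natCast, Nat.cast_one, one_div]
    simp_rw [this]
    rw [Finset.prod_const, Finset.card_univ, ← ENNReal.ofReal_pow (by positivity), inv_pow]
  rw [← sum_measure_singleton, Finset.sum_congr rfl hsing, Finset.sum_const, nsmul_eq_mul,
    div_eq_mul_inv, ENNReal.ofReal_mul (by positivity), ENNReal.ofReal_natCast]

/-- Lower bound on the probability of list colourability for a linear uniform hypergraph. -/
lemma ofReal_one_sub_le_randomListAssignment {V : Type*} [Fintype V] {H : Hypergraph V} {s : ℕ}
    (hs : 1 ≤ s) (hunif : H.IsUniform (s + 1)) (hlin : H.IsLinear) {k σ : ℕ} (hk : 1 ≤ k)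
    (hkσ : k ≤ σ) {D : ℝ} (hD : D * (Real.exp 1 * (s + 1)) ≤ ((k : ℝ) / 2) ^ s)
    (hdeg : H.maxDegree * ((k : ℝ) / σ) ^ s ≤ D / 2) :
    ENNReal.ofReal (1 - Fintype.card V *
        (2 ^ k * Real.exp (-(k / 2 * (D * (Real.log 2 - 1 / 2)))))) ≤
      randomListAssignment V k σ {L | H.IsListColorable L} := by
  classical
  set E : Finset (Finset V) := Finset.univ.filter fun e => (e : Set V) ∈ E(H) with hEdef
  have hmem : ∀ e : Finset V, e ∈ E ↔ (e : Set V) ∈ E(H) := fun e => by simp [hEdef]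
  have hE : ∀ e ∈ E, e.card = s + 1 := fun e he => by
    have := hunif _ ((hmem e).1 he)
    rw [Set.encard_coe_eq_coe_finsetCard] at this
    exact_mod_cast this
  set P := Finset.powersetCard k (Finset.univ : Finset (Fin σ)) with hP
  set Ω := Fintype.piFinset fun _ : V => P with hΩ
  set I : V → Finset (Finset V) := fun v => E.filter fun e => v ∈ e with hI
  set B : V → Finset (V → Finset (Fin σ)) := fun v => Ω.filter fun L =>
    k < 2 * ((L v).filter fun c => D < ((I v).filter fun e => ∀ u ∈ e, c ∈ L u).card).card with hB
  have hIdeg : ∀ v, (I v).card ≤ H.maxDegree := by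
    intro v
    refine le_trans ?_ (Finset.le_sup (f := H.degree) (Finset.mem_univ v))
    rw [← Set.ncard_coe_finset, ← Set.ncard_image_of_injective _ Finset.coe_injective]
    refine Set.ncard_le_ncard ?_ (Set.toFinite _)
    rintro _ ⟨e, he, rfl⟩
    obtain ⟨he, hv⟩ := Finset.mem_filter.1 (Finset.mem_coe.1 he)
    exact ⟨(hmem e).1 he, Finset.mem_coe.2 hv⟩
  have hPpos : (0 : ℝ) < P.card := by
    rw [hP, Finset.card_powersetCard]
    exact_mod_cast Nat.choose_pos (by simpa using hkσ)
  have hBcard : ∀ v, ((B v).card : ℝ) ≤ (P.card : ℝ) ^ Fintype.card V *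
      (2 ^ k * Real.exp (-(k / 2 * (D * (Real.log 2 - 1 / 2))))) := by
    intro v
    refine card_many_high_degree_colors_le (q := (k : ℝ) / σ) (s := s) (by positivity)
      (fun S => ?_) (fun T hT => (Finset.mem_powersetCard.1 hT).2)
      (fun e he => (Finset.mem_filter.1 he).2) (fun e he => hE e (Finset.mem_filter.1 he).1)
      (fun u hu e he f hf hue huf => ?_) ?_
    · simpa using card_filter_superset_powersetCard_le (γ := Fin σ) (by simpa using hkσ) S
    · obtain ⟨he, hve⟩ := Finset.mem_filter.1 he
      obtain ⟨hf, hvf⟩ := Finset.mem_filter.1 hf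
      exact Finset.coe_injective (hlin u v hu _ ((hmem e).1 he) _ ((hmem f).1 hf)
        (Finset.mem_coe.2 hue) (Finset.mem_coe.2 hve) (Finset.mem_coe.2 huf)
        (Finset.mem_coe.2 hvf))
    · refine le_trans ?_ hdeg
      gcongr
      exact hIdeg v
  set bad := Finset.univ.biUnion B with hbad
  have hbadΩ : bad ⊆ Ω := Finset.biUnion_subset.2 fun v _ => Finset.filter_subset _ _
  have hbadcard : (bad.card : ℝ) ≤ (P.card : ℝ) ^ Fintype.card V * (Fintype.card V *
      (2 ^ k * Real.exp (-(k / 2 * (D * (Real.log 2 - 1 / 2)))))) := by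
    calc (bad.card : ℝ) ≤ ∑ v, ((B v).card : ℝ) := by exact_mod_cast Finset.card_biUnion_le
      _ ≤ _ := Finset.sum_le_sum fun v _ => hBcard v
      _ = _ := by rw [Finset.sum_const, nsmul_eq_mul, Finset.card_univ]; ring
  have hgood : ((Ω \ bad : Finset (V → Finset (Fin σ))) : Set (V → Finset (Fin σ))) ⊆
      {L | H.IsListColorable L} := by
    intro L hL
    obtain ⟨hLΩ, hLb⟩ := Finset.mem_sdiff.1 (Finset.mem_coe.1 hL)
    obtain ⟨f, hf, hfE⟩ := exists_coloring_of_few_high_degree_colors hs hE hk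
      (fun v => (Finset.mem_powersetCard.1 (Fintype.mem_piFinset.1 hLΩ v)).2) hD
      fun v => not_lt.1 fun h => hLb (Finset.mem_biUnion.2 ⟨v, Finset.mem_univ v,
        Finset.mem_filter.2 ⟨hLΩ, h⟩⟩)
    refine ⟨f, fun e he ⟨c, hc⟩ => ?_, fun v _ => hf v⟩
    exact hfE e.toFinset ((hmem _).2 (by simpa using he))
      ⟨c, fun u hu => hc u (Set.mem_toFinset.1 hu)⟩
  refine le_trans ?_ (measure_mono hgood)
  rw [randomListAssignment_apply_finset hkσ Finset.sdiff_subset]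
  refine ENNReal.ofReal_le_ofReal ?_
  have hΩcard : Ω.card = P.card ^ Fintype.card V := by
    rw [hΩ, Fintype.card_piFinset, Finset.prod_const, Finset.card_univ]
  rw [le_div_iff₀ (by positivity), Finset.card_sdiff_of_subset hbadΩ,
    Nat.cast_sub (Finset.card_le_card hbadΩ), hΩcard, Nat.cast_pow]
  linarith

end Assembly

/-! ### Choice of constants and the limit. -/

theorem mainTheorem1 (r : ℕ) (hr : 2 ≤ r) (C : ℝ)
    (hC : ((2 : ℝ) ^ r * Real.exp 1 * r) ^ (1 / ((r : ℝ) - 1)) < C) :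
    ∃ A : ℝ, 0 < A ∧
      ∀ (H : (n : ℕ) → Hypergraph (Fin n)) (k σ : ℕ → ℕ),
        (∀ n, V(H n) = Set.univ) →
        (∀ n, (H n).IsUniform r) →
        (∀ n, (H n).IsLinear) →
        (∀ n, k n ≤ σ n) →
        (∀ n : ℕ, A * Real.log n ^ (1 / (r : ℝ)) ≤ k n) →
        (∀ n, C * ((H n).maxDegree : ℝ) ^ (1 / ((r : ℝ) - 1)) ≤ σ n) →
        Tendsto
          (fun n => randomListAssignment (Fin n) (k n) (σ n) {L | (H n).IsListColorable L})
          atTop (𝓝 1) := by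
  obtain ⟨s, rfl⟩ : ∃ s, r = s + 1 := ⟨r - 1, by omega⟩
  have hs : 1 ≤ s := by omega
  have hs0 : s ≠ 0 := by omega
  have hexp : (1 / (((s + 1 : ℕ) : ℝ) - 1)) = (s : ℝ)⁻¹ := by push_cast; rw [one_div]; ring_nf
  have hC0 : 0 < C := lt_of_le_of_lt (by positivity) hC
  have hCs : (2 : ℝ) ^ (s + 1) * Real.exp 1 * (s + 1) ≤ C ^ s := by
    rw [hexp] at hC
    have := pow_le_pow_left₀ (by positivity) hC.le s
    rw [Real.rpow_inv_natCast_pow (by positivity) hs0] at this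
    exact_mod_cast this
  have hlog : 0 < Real.log 2 - 1 / 2 := by linarith [Real.log_two_gt_d9]
  -- With D = 2(k/C)^s the tail exponent (k/2) D (log 2 - 1/2) equals c k^(s+1).
  set c : ℝ := (Real.log 2 - 1 / 2) / C ^ s with hc
  have hc0 : 0 < c := by positivity
  set A : ℝ := max 1 (4 / c) with hA
  have hA1 : 1 ≤ A := le_max_left _ _
  have hAc : 4 / c ≤ A := le_max_right _ _
  refine ⟨A, by positivity, fun H k σ _ hunif hlin hkσ hk hσ => ?_⟩
  have hlim : Tendsto (fun n : ℕ => ENNReal.ofReal (1 - 1 / (n : ℝ))) atTop (𝓝 1) := by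
    have h1 : Tendsto (fun n : ℕ => 1 - 1 / (n : ℝ)) atTop (𝓝 (1 - 0)) :=
      tendsto_const_nhds.sub tendsto_one_div_atTop_nhds_zero_nat
    simpa using ENNReal.tendsto_ofReal h1
  have hlarge : ∀ᶠ n : ℕ in atTop, max 1 (2 / c) ≤ Real.log n ^ (1 / ((s + 1 : ℕ) : ℝ)) :=
    ((tendsto_rpow_atTop (by positivity)).comp
      (Real.tendsto_log_atTop.comp tendsto_natCast_atTop_atTop)).eventually_ge_atTop _
  refine tendsto_of_tendsto_of_tendsto_of_le_of_le' hlim tendsto_const_nhds ?_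
    (Eventually.of_forall fun n => ?_)
  swap
  · have := isProbabilityMeasure_randomListAssignment (Fin n) (hkσ n)
    exact prob_le_one
  filter_upwards [hlarge, eventually_ge_atTop 1] with n hn hn1
  have hn0 : (0 : ℝ) < n := by exact_mod_cast hn1
  have hlogn : 0 ≤ Real.log n := Real.log_natCast_nonneg n
  have hkn : max 1 (2 / c) ≤ (k n : ℝ) :=
    hn.trans ((le_mul_of_one_le_left (by positivity) hA1).trans (hk n))
  have hk1R : (1 : ℝ) ≤ k n := (le_max_left _ _).trans hkn
  have hk1 : 1 ≤ k n := by exact_mod_cast hk1R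
  have hσ0 : (0 : ℝ) < σ n := by exact_mod_cast hk1.trans (hkσ n)
  have hdeg : C ^ s * (H n).maxDegree ≤ (σ n : ℝ) ^ s := by
    have := hσ n
    rw [hexp] at this
    have := pow_le_pow_left₀ (by positivity) this s
    rwa [mul_pow, Real.rpow_inv_natCast_pow (by positivity) hs0] at this
  refine le_trans (ENNReal.ofReal_le_ofReal ?_) (ofReal_one_sub_le_randomListAssignment hs
    (hunif n) (hlin n) hk1 (hkσ n) (D := 2 * (k n / C) ^ s) ?_ ?_)
  · rw [Fintype.card_fin]
    refine sub_le_sub_left ?_ 1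
    have h1 : (2 : ℝ) ^ k n = Real.exp (k n * Real.log 2) := by
      rw [Real.exp_nat_mul, Real.exp_log two_pos]
    have h2 : (k n : ℝ) / 2 * (2 * (k n / C) ^ s * (Real.log 2 - 1 / 2)) =
        c * (k n : ℝ) ^ (s + 1) := by
      rw [hc, div_pow]; field_simp; ring
    -- Half of the exponent absorbs 2^k, using k ≥ 2/c; the other half is at least 2 log n, using A
    -- ≥ 4/c. The failure probability is thus at most n · n^(-2) = 1/n.
    have h3 : (k n : ℝ) * Real.log 2 ≤ c / 2 * (k n : ℝ) ^ (s + 1) := by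
      have h4 : (k n : ℝ) ≤ (k n : ℝ) ^ s := le_self_pow₀ hk1R hs0
      have h5 : 1 ≤ c / 2 * (k n : ℝ) ^ s := by
        calc (1 : ℝ) = c / 2 * (2 / c) := by field_simp
          _ ≤ c / 2 * (k n : ℝ) ^ s := by
            gcongr; exact ((le_max_right _ _).trans hkn).trans h4
      have h6 : Real.log 2 ≤ 1 := by linarith [Real.log_two_lt_d9]
      calc (k n : ℝ) * Real.log 2 ≤ k n * (c / 2 * (k n : ℝ) ^ s) := by gcongr; linarith
        _ = _ := by ring
    have h7 : 2 * Real.log n ≤ c / 2 * (k n : ℝ) ^ (s + 1) := by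
      have h8 := pow_le_pow_left₀ (by positivity) (hk n) (s + 1)
      rw [mul_pow, one_div, Real.rpow_inv_natCast_pow hlogn (by omega)] at h8
      have h9 : 4 / c ≤ A ^ (s + 1) := hAc.trans (le_self_pow₀ hA1 (by omega))
      calc 2 * Real.log n = c / 2 * (4 / c * Real.log n) := by field_simp; ring
        _ ≤ c / 2 * (A ^ (s + 1) * Real.log n) := by gcongr
        _ ≤ _ := by gcongr
    calc (n : ℝ) * (2 ^ k n * Real.exp (-(k n / 2 * (2 * (k n / C) ^ s * (Real.log 2 - 1 / 2)))))
        = n * Real.exp (k n * Real.log 2 - c * (k n : ℝ) ^ (s + 1)) := by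
          rw [h1, h2, ← Real.exp_add]; rfl
      _ ≤ n * Real.exp (-Real.log n + -Real.log n) := by gcongr; linarith
      _ = 1 / n := by
          rw [Real.exp_add, Real.exp_neg, Real.exp_log hn0]; field_simp
  -- The lower bound on C is used exactly here.
  · rw [div_pow, div_pow, mul_div_assoc', div_mul_eq_mul_div,
      div_le_div_iff₀ (by positivity) (by positivity)]
    calc 2 * (k n : ℝ) ^ s * (Real.exp 1 * (s + 1)) * 2 ^ s
        = (k n : ℝ) ^ s * (2 ^ (s + 1) * Real.exp 1 * (s + 1)) := by ring
      _ ≤ _ := by gcongr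
  · rw [mul_div_cancel_left₀ _ two_ne_zero, div_pow, div_pow, mul_div_assoc',
      div_le_div_iff₀ (by positivity) (by positivity)]
    calc ((H n).maxDegree : ℝ) * (k n : ℝ) ^ s * C ^ s
        = (k n : ℝ) ^ s * (C ^ s * (H n).maxDegree) := by ring
      _ ≤ _ := by gcongr
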